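/- Let $Y$ be a finite dimensional Euclidean space, $K\subseteq Y$ a closed convex cone (i.e. $\lambda x\in K$ for all $x\in K$, $\lambda\ge 0$), $L\subseteq Y$ a linear subspace and $z_0\in Y$. Write $K^*=\{y:\langle y,x\rangle\ge 0\ \forall x\in K\}$, $\operatorname{lin}S$ for the linear span of a set $S$, $S^\perp$ for the orthogonal complement of $\operatorname{lin}S$, and $\operatorname{ri}$, $\operatorname{cl}$ for relative interior and closure. For a convex set $C$ and $x\in C$ let $$\operatorname{dir}(x,C)=\{y: x+\varepsilon y\in C\text{ for some }\varepsilon>0\},\quad \operatorname{ldir}(x,C)=\operatorname{dir}(x,C)\cap-\operatorname{dir}(x,C),\quad \tan(x,C)=\operatorname{cl}\operatorname{dir}(x,C)\cap-\operatorname{cl}\operatorname{dir}(x,C).$$ A convex set $E\subseteq K$ is a face of $K$ if $x_1,x_2\in K$ and $\tfrac12(x_1+x_2)\in E$ imply $x_1,x_2\in E$; its conjugate face is $E^\triangle=K^*\cap E^\perp$. A vector $u\in K^*$ is strictly complementary to $x\in K$ if $x\in\operatorname{ri}E$ and $u\in\operatorname{ri}E^\triangle$ for some face $E$ of $K$. Let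 $P'=(z_0+L)\cap K$. The system $P'$ is called well-behaved if for every $y_0\in Y$ for which $v=\inf\{\langle y_0,x\rangle: x\in P'\}$ is finite, there is $y\in(y_0+L^\perp)\cap K^*$ with $\langle z_0,y\rangle+v=\langle z_0,y_0\rangle$. **Theorem.** Let $z\in\operatorname{ri}P'$ and consider the statements - (1') The system $P'$ is well-behaved. - (2') The set $\{(w+k,\,-\langle z_0,w\rangle+s): w\in L^\perp,\ k\in K^*,\ s\ge 0\}\subseteq Y\times\mathbb R$ is closed. - (3') The set $(L+z_0)^\perp+K^*$ is closed. - (4') $\operatorname{lin}(L+z_0)\cap(\operatorname{cl}\operatorname{dir}(z,K)\setminus\operatorname{dir}(z,K))=\emptyset$. - (5') There is $u\in(L+z_0)^\perp$ strictly complementary to $z$, and $\operatorname{lin}(L+z_0)\cap(\tan(z,K)\setminus\operatorname{ldir}(z,K))=\emptyset$. Then $(1')\Leftrightarrow(2')$, $(3')\Rightarrow(2')$, $(2')\Rightarrow(4')$ and $(4')\Leftrightarrow(5')$. Moreover, let $F$ be the smallest face of $K$ that contains $z$. If the set $K^*+F^\perp$ is closed, then (1') through (5') are all equivalent. -/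

import Mathlib

open scoped Pointwise

noncomputable section

namespace ConicSubspace

variable {Y : Type*} [NormedAddCommGroup Y] [InnerProductSpace ℝ Y]

/-- The dual cone `C^* = {y | ⟨y, x⟩ ≥ 0 for all x ∈ C}`. -/
def dualCone (C : Set Y) : Set Y := {y | ∀ x ∈ C, 0 ≤ inner ℝ y x}

/-- The linear span `lin S`, as a subspace. -/
abbrev lin (S : Set Y) : Submodule ℝ Y := Submodule.span ℝ S

/-- `S^⊥`, the orthogonal complement of `lin S`. -/
def perp (S : Set Y) : Set Y := ((lin S)ᗮ : Submodule ℝ Y)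

/-- The relative interior of a convex set. -/
abbrev ri (C : Set Y) : Set Y := intrinsicInterior ℝ C

/-- The feasible directions at `x` in `C`. -/
def dir (x : Y) (C : Set Y) : Set Y := {y | ∃ ε : ℝ, 0 < ε ∧ x + ε • y ∈ C}

/-- The lineality space of `dir x C`. -/
def ldir (x : Y) (C : Set Y) : Set Y := dir x C ∩ -dir x C

/-- The tangent space at `x` in `C`. -/
def tanSpace (x : Y) (C : Set Y) : Set Y := closure (dir x C) ∩ -closure (dir x C)

/-- `E` is a face of the convex cone `C`: a convex subset such that a midpoint of two points of
`C` lies in `E` only if both points do. -/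
structure IsFace (C E : Set Y) : Prop where
  subset : E ⊆ C
  convex : Convex ℝ E
  mem_of_midpoint_mem : ∀ x₁ ∈ C, ∀ x₂ ∈ C, (1 / 2 : ℝ) • (x₁ + x₂) ∈ E → x₁ ∈ E ∧ x₂ ∈ E

/-- The smallest face of `C` that contains `x`. -/
def smallestFace (C : Set Y) (x : Y) : Set Y := ⋂₀ {E | IsFace C E ∧ x ∈ E}

/-- For a convex `C` and `x ∈ C`, `smallestFace C x` is indeed the least face containing `x`. -/
theorem isLeast_smallestFace {C : Set Y} (hC : Convex ℝ C) {x : Y} (hx : x ∈ C) :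
    IsLeast {E | IsFace C E ∧ x ∈ E} (smallestFace C x) := by
  refine ⟨⟨⟨?_, ?_, ?_⟩, ?_⟩, fun E hE => Set.sInter_subset_of_mem hE⟩
  · exact Set.sInter_subset_of_mem ⟨⟨subset_rfl, hC, fun x₁ h₁ x₂ h₂ _ => ⟨h₁, h₂⟩⟩, hx⟩
  · exact convex_sInter fun E hE => hE.1.convex
  · intro x₁ h₁ x₂ h₂ h
    exact ⟨fun E hE => (hE.1.mem_of_midpoint_mem x₁ h₁ x₂ h₂ (h E hE)).1,
      fun E hE => (hE.1.mem_of_midpoint_mem x₁ h₁ x₂ h₂ (h E hE)).2⟩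
  · exact fun E hE => hE.2

/-- The conjugate face `C^* ∩ E^⊥` of a face `E` of `C`. -/
def conjugateFace (C E : Set Y) : Set Y := dualCone C ∩ perp E

/-- `u ∈ C^*` is strictly complementary to `x`: for the face `E` of `C` with `x ∈ ri E`, the
vector `u` lies in the relative interior of the conjugate face of `E`. -/
def StrictlyComplementary (C : Set Y) (u x : Y) : Prop :=
  u ∈ dualCone C ∧ ∃ E, IsFace C E ∧ x ∈ ri E ∧ u ∈ ri (conjugateFace C E)

/-- The conic system in subspace form `P' = (z₀ + L) ∩ K`. -/
def system (z₀ : Y) (L : Submodule ℝ Y) (K : Set Y) : Set Y := ({z₀} + (L : Set Y)) ∩ K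

/-- The value `inf {⟨y₀, z⟩ | z ∈ (z₀ + L) ∩ K}` of the primal problem with objective `y₀`, as an
extended real number. -/
def primalVal (z₀ : Y) (L : Submodule ℝ Y) (K : Set Y) (y₀ : Y) : EReal :=
  ⨅ z ∈ system z₀ L K, ((inner ℝ y₀ z : ℝ) : EReal)

/-- The feasible set `(y₀ + L^⊥) ∩ K^*` of the dual problem with parameter `y₀`. -/
def dualFeasible (L : Submodule ℝ Y) (K : Set Y) (y₀ : Y) : Set Y :=
  ({y₀} + ((Lᗮ : Submodule ℝ Y) : Set Y)) ∩ dualCone K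

/-- The system `(z₀ + L) ∩ K` is well-behaved: for every objective `y₀` for which the primal value
is a finite number `v`, some dual feasible `y` has `⟨z₀, y⟩ + v = ⟨z₀, y₀⟩`. -/
def WellBehaved (z₀ : Y) (L : Submodule ℝ Y) (K : Set Y) : Prop :=
  ∀ (y₀ : Y) (v : ℝ), primalVal z₀ L K y₀ = (v : EReal) →
    ∃ y ∈ dualFeasible L K y₀, inner ℝ z₀ y + v = inner ℝ z₀ y₀

/-- The set `(I; -z₀^*) L^⊥ + K^* × ℝ₊` is closed in `Y × ℝ`. -/
def ExtendedSumClosed (z₀ : Y) (L : Submodule ℝ Y) (K : Set Y) : Prop :=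
  IsClosed ((fun w : Y => ((w, -inner ℝ z₀ w) : Y × ℝ)) '' ((Lᗮ : Submodule ℝ Y) : Set Y)
    + dualCone K ×ˢ Set.Ici (0 : ℝ))

/-- The set `(L + z₀)^⊥ + K^*` is closed. -/
def SumClosed (z₀ : Y) (L : Submodule ℝ Y) (K : Set Y) : Prop :=
  IsClosed (perp ((L : Set Y) + {z₀}) + dualCone K)

/-- `lin (L + z₀) ∩ (cl dir(z, K) \ dir(z, K)) = ∅`. -/
def FrontierCondition (z₀ : Y) (L : Submodule ℝ Y) (K : Set Y) (z : Y) : Prop :=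
  (lin ((L : Set Y) + {z₀}) : Set Y) ∩ (closure (dir z K) \ dir z K) = ∅

/-- Some `u ∈ (L + z₀)^⊥` is strictly complementary to `z`, and
`lin (L + z₀) ∩ (tan(z, K) \ ldir(z, K)) = ∅`. -/
def TangentCondition (z₀ : Y) (L : Submodule ℝ Y) (K : Set Y) (z : Y) : Prop :=
  (∃ u ∈ perp ((L : Set Y) + {z₀}), StrictlyComplementary K u z) ∧
    (lin ((L : Set Y) + {z₀}) : Set Y) ∩ (tanSpace z K \ ldir z K) = ∅

end ConicSubspace

end

/-! The closure of the set in (2') consists of the pairs `(y, r)` for which `-r` is a lower bound of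
`⟨y, ·⟩` on the system, and dual attainment at a finite value `v` says that `(y₀, -v)` lies in the
set itself. Hence (1') and (2') both say that the set contains its closure
(`mem_closure_extendedSum_iff`, `exists_dualFeasible_iff`).

The facial part rests on two facts. The closure of `dir z K` is the dual cone of `F^△ = K^* ∩ z^⊥`
(`mem_closure_dir_iff`), and `lin (L + z₀) ∩ dir z K` is a subspace because `z` is a relative
interior point (`neg_mem_dir_of_mem_ri_system`). A point violating (4') can therefore be separated
from a subspace, which gives an objective without dual attainment. Conversely, (4') makes the dual
of `(L + z₀)^⊥ + F^△` a subspace. In finite dimension that cone is then itself a subspace, closed or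
not a priori (`mem_of_dual_symm`); this supplies the strictly complementary vector in (5') and the
inclusion `F^⊥ ⊆ (L + z₀)^⊥ + F^△`.

The closedness claims (3') ⇒ (2') and (4') ⇒ (3') both use `isClosed_add_of_inner_pos`, with `z` as
the functional that is positive on one summand. -/

namespace ConicSubspace

/-! ### Convex cones, separation and relative interiors. -/

section Cones

variable {E : Type*} [NormedAddCommGroup E] [NormedSpace ℝ E]

/-- A set that is a (pointed) convex cone. -/
structure IsConvexCone (S : Set E) : Prop where
  zero_mem : (0 : E) ∈ S
  add_mem : ∀ {x y : E}, x ∈ S → y ∈ S → x + y ∈ S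
  smul_mem : ∀ {x : E} {t : ℝ}, x ∈ S → 0 ≤ t → t • x ∈ S

theorem IsConvexCone.convex {S : Set E} (hS : IsConvexCone S) : Convex ℝ S :=
  fun _ hx _ hy _ _ ha hb _ => hS.add_mem (hS.smul_mem hx ha) (hS.smul_mem hy hb)

theorem IsConvexCone.of_convex {S : Set E} (hne : S.Nonempty) (hS : Convex ℝ S)
    (hsmul : ∀ x ∈ S, ∀ t : ℝ, 0 ≤ t → t • x ∈ S) : IsConvexCone S where
  zero_mem := by
    obtain ⟨x, hx⟩ := hne
    simpa using hsmul x hx 0 le_rfl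
  add_mem {x y} hx hy := by
    have h := hsmul _ (hS hx hy (a := 1 / 2) (b := 1 / 2) (by norm_num) (by norm_num)
      (by norm_num)) 2 (by norm_num)
    simpa [smul_smul] using h
  smul_mem hx ht := hsmul _ hx _ ht

theorem IsConvexCone.add {S T : Set E} (hS : IsConvexCone S) (hT : IsConvexCone T) :
    IsConvexCone (S + T) where
  zero_mem := ⟨0, hS.zero_mem, 0, hT.zero_mem, add_zero 0⟩
  add_mem := by
    rintro _ _ ⟨a, ha, b, hb, rfl⟩ ⟨c, hc, d, hd, rfl⟩
    exact ⟨a + c, hS.add_mem ha hc, b + d, hT.add_mem hb hd, add_add_add_comm _ _ _ _⟩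
  smul_mem := by
    rintro _ t ⟨a, ha, b, hb, rfl⟩ ht
    exact ⟨t • a, hS.smul_mem ha ht, t • b, hT.smul_mem hb ht, (smul_add _ _ _).symm⟩

theorem IsConvexCone.inter {S T : Set E} (hS : IsConvexCone S) (hT : IsConvexCone T) :
    IsConvexCone (S ∩ T) where
  zero_mem := ⟨hS.zero_mem, hT.zero_mem⟩
  add_mem hx hy := ⟨hS.add_mem hx.1 hy.1, hT.add_mem hx.2 hy.2⟩
  smul_mem hx ht := ⟨hS.smul_mem hx.1 ht, hT.smul_mem hx.2 ht⟩

theorem isConvexCone_submodule (M : Submodule ℝ E) : IsConvexCone (M : Set E) where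
  zero_mem := M.zero_mem
  add_mem := M.add_mem
  smul_mem hx _ := M.smul_mem _ hx

/-- A functional bounded below on a convex cone is nonnegative on it. -/
theorem IsConvexCone.nonneg_of_bddBelow {S : Set E} (hS : IsConvexCone S) {f : E →ₗ[ℝ] ℝ} {u : ℝ}
    (h : ∀ a ∈ S, u ≤ f a) {a : E} (ha : a ∈ S) : 0 ≤ f a := by
  by_contra! hneg
  have h0 : u ≤ 0 := by simpa using h 0 hS.zero_mem
  have ht : 0 ≤ (u - 1) / f a := div_nonneg_of_nonpos (by linarith) hneg.le
  -- The factor scales `a` to a point where `f` equals `u - 1`.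
  have := h _ (hS.smul_mem ha ht)
  rw [map_smul, smul_eq_mul, div_mul_cancel₀ _ hneg.ne] at this
  linarith

theorem IsConvexCone.exists_functional {S : Set E} (hS : IsConvexCone S) {x : E}
    (hx : x ∉ closure S) : ∃ f : StrongDual ℝ E, (∀ a ∈ S, 0 ≤ f a) ∧ f x < 0 := by
  obtain ⟨f, u, hfx, hf⟩ := geometric_hahn_banach_point_closed hS.convex.closure isClosed_closure hx
  have hu : u < 0 := by simpa using hf 0 (subset_closure hS.zero_mem)
  exact ⟨f, fun a ha => hS.nonneg_of_bddBelow (f := f.toLinearMap)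
    (fun b hb => (hf b (subset_closure hb)).le) ha, hfx.trans hu⟩

/-- The relative interior, with distances. -/
theorem mem_ri_iff_dist {C : Set E} {x : E} :
    x ∈ intrinsicInterior ℝ C ↔ x ∈ C ∧ ∃ δ > 0, ∀ y ∈ affineSpan ℝ C, dist y x < δ → y ∈ C := by
  rw [mem_intrinsicInterior]
  constructor
  · rintro ⟨⟨x', hx'⟩, hx, rfl⟩
    refine ⟨(interior_subset hx : _ ∈ Subtype.val ⁻¹' C), ?_⟩
    obtain ⟨δ, hδ, h⟩ := Metric.mem_nhds_iff.1 (mem_interior_iff_mem_nhds.1 hx)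
    exact ⟨δ, hδ, fun y hy hyx => h (show (⟨y, hy⟩ : affineSpan ℝ C) ∈ Metric.ball _ δ from hyx)⟩
  · rintro ⟨hx, δ, hδ, h⟩
    refine ⟨⟨x, subset_affineSpan ℝ C hx⟩, ?_, rfl⟩
    rw [mem_interior_iff_mem_nhds, Metric.mem_nhds_iff]
    exact ⟨δ, hδ, fun y hy => h y y.2 hy⟩

/-- A point of a convex set is a relative interior point iff every segment of the set that ends
in it can be prolonged. -/
theorem mem_ri_iff [FiniteDimensional ℝ E] {C : Set E} (hC : Convex ℝ C) {x : E} :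
    x ∈ intrinsicInterior ℝ C ↔ x ∈ C ∧ ∀ y ∈ C, ∃ ε : ℝ, 0 < ε ∧ x + ε • (x - y) ∈ C := by
  constructor
  · intro hx
    obtain ⟨hxC, δ, hδ, h⟩ := mem_ri_iff_dist.1 hx
    refine ⟨hxC, fun y hy => ⟨δ / (2 * (‖x - y‖ + 1)), by positivity, h _ ?_ ?_⟩⟩
    · have := AffineMap.lineMap_mem (Q := affineSpan ℝ C) (-(δ / (2 * (‖x - y‖ + 1))))
        (subset_affineSpan ℝ C hxC) (subset_affineSpan ℝ C hy)
      rw [AffineMap.lineMap_apply_module'] at this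
      convert this using 1
      module
    · rw [dist_eq_norm, add_sub_cancel_left, norm_smul, Real.norm_of_nonneg (by positivity),
        div_mul_eq_mul_div, div_lt_iff₀ (by positivity)]
      nlinarith [norm_nonneg (x - y)]
  · rintro ⟨hxC, h⟩
    -- Prolong the segment from a relative interior point `x₀` beyond `x` to `x' ∈ C`. The homothety
    -- with centre `x'` and ratio `c` takes `x₀` to `x`, and a relative ball around `x₀` to one
    -- around `x`.
    obtain ⟨x₀, hx₀⟩ := Set.Nonempty.intrinsicInterior hC ⟨x, hxC⟩
    obtain ⟨hx₀C, δ, hδ, hball⟩ := mem_ri_iff_dist.1 hx₀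
    obtain ⟨ε, hε, hx'⟩ := h x₀ hx₀C
    set x' := x + ε • (x - x₀) with hx'_def
    set c := ε / (1 + ε) with hc_def
    have hc : 0 < c := by positivity
    have hc1 : c ≤ 1 := by rw [hc_def, div_le_one (by positivity)]; linarith
    have hxc : x = x' + c • (x₀ - x') := by
      have : (1 + ε) • x = (1 + ε) • (x' + c • (x₀ - x')) := by
        rw [smul_add, smul_smul, hc_def, mul_div_cancel₀ _ (by positivity), hx'_def]
        module
      exact smul_right_injective E (by positivity : (1 + ε) ≠ 0) this
    refine mem_ri_iff_dist.2 ⟨hxC, c * δ, by positivity, fun y hy hyx => ?_⟩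
    have hmem : x' + c⁻¹ • (y - x') ∈ C := by
      refine hball _ ?_ ?_
      · have := AffineMap.lineMap_mem (Q := affineSpan ℝ C) c⁻¹ (subset_affineSpan ℝ C hx') hy
        rw [AffineMap.lineMap_apply_module'] at this
        rwa [add_comm]
      · have : x' + c⁻¹ • (y - x') - x₀ = c⁻¹ • (y - x) := by
          have h1 : c⁻¹ • (y - x) = c⁻¹ • (y - x') - (c⁻¹ * c) • (x₀ - x') := by
            nth_rw 1 [hxc]
            module
          rw [h1, inv_mul_cancel₀ hc.ne']
          module
        rw [dist_eq_norm, this, norm_smul, Real.norm_of_nonneg (by positivity), ← dist_eq_norm,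
          inv_mul_lt_iff₀ hc]
        exact hyx
    have := hC.add_smul_sub_mem hx' hmem ⟨hc.le, hc1⟩
    rwa [add_sub_cancel_left, smul_smul, mul_inv_cancel₀ hc.ne', one_smul,
      add_sub_cancel] at this

theorem IsConvexCone.mem_ri_iff [FiniteDimensional ℝ E] {C : Set E} (hC : IsConvexCone C) {x : E} :
    x ∈ intrinsicInterior ℝ C ↔ x ∈ C ∧ ∀ y ∈ C, ∃ ε : ℝ, 0 < ε ∧ x - ε • y ∈ C := by
  rw [ConicSubspace.mem_ri_iff hC.convex]
  refine and_congr_right fun hx => forall₂_congr fun y hy => ⟨?_, ?_⟩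
  · rintro ⟨ε, hε, h⟩
    refine ⟨(1 + ε)⁻¹ * ε, by positivity, ?_⟩
    convert hC.smul_mem h (t := (1 + ε)⁻¹) (by positivity) using 1
    have : x + ε • (x - y) = (1 + ε) • x - ε • y := by module
    rw [this, smul_sub, smul_smul, smul_smul, inv_mul_cancel₀ (by positivity), one_smul]
  · rintro ⟨ε, hε, h⟩
    refine ⟨ε, hε, ?_⟩
    convert hC.add_mem h (hC.smul_mem hx hε.le) using 1
    module

end Cones

/-! ### Dual cones and closedness of sums in Euclidean space. -/

section Inner

variable {Y : Type*} [NormedAddCommGroup Y] [InnerProductSpace ℝ Y]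

theorem mem_perp {S : Set Y} {w : Y} : w ∈ perp S ↔ ∀ x ∈ S, inner ℝ x w = 0 := by
  refine ⟨fun h x hx => (Submodule.mem_orthogonal _ _).1 h x (Submodule.subset_span hx),
    fun h => (Submodule.mem_orthogonal _ _).2 fun x hx => ?_⟩
  induction hx using Submodule.span_induction with
  | mem x hx => exact h x hx
  | zero => simp
  | add x y _ _ h1 h2 => simp [inner_add_left, h1, h2]
  | smul t x _ h1 => simp [inner_smul_left, h1]

theorem isConvexCone_perp (S : Set Y) : IsConvexCone (perp S) := isConvexCone_submodule _

theorem isConvexCone_dualCone (S : Set Y) : IsConvexCone (dualCone S) where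
  zero_mem x _ := by simp
  add_mem hx hy a ha := by
    rw [inner_add_left]
    exact add_nonneg (hx a ha) (hy a ha)
  smul_mem hx ht a ha := by
    rw [real_inner_smul_left]
    exact mul_nonneg ht (hx a ha)

theorem IsConvexCone.exists_inner [CompleteSpace Y] {S : Set Y} (hS : IsConvexCone S) {x : Y}
    (hx : x ∉ closure S) : ∃ y ∈ dualCone S, inner ℝ y x < 0 := by
  obtain ⟨f, hf, hfx⟩ := hS.exists_functional hx
  refine ⟨(InnerProductSpace.toDual ℝ Y).symm f, fun a ha => ?_, ?_⟩ <;>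
    rw [InnerProductSpace.toDual_symm_apply]
  exacts [hf a ha, hfx]

theorem IsConvexCone.mem_of_inner_nonneg [CompleteSpace Y] {S : Set Y} (hS : IsConvexCone S)
    (hcl : IsClosed S) {x : Y} (hx : ∀ y ∈ dualCone S, 0 ≤ inner ℝ y x) : x ∈ S := by
  by_contra h
  rw [← hcl.closure_eq] at h
  obtain ⟨y, hy, hyx⟩ := hS.exists_inner h
  exact (hx y hy).not_gt hyx

/-- In finite dimension a convex cone whose dual is trivial is the whole space. -/
theorem IsConvexCone.eq_univ [FiniteDimensional ℝ Y] {S : Set Y} (hS : IsConvexCone S)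
    (h : ∀ d ∈ dualCone S, d = 0) : S = Set.univ := by
  have hspan : Submodule.span ℝ S = ⊤ := by
    rw [← Submodule.orthogonal_eq_bot_iff, Submodule.eq_bot_iff]
    refine fun d hd => h d fun x hx => ?_
    rw [real_inner_comm, mem_perp.1 hd x hx]
  -- A nonempty interior allows separation from any point outside `S`, although `S` need not be
  -- closed.
  have hint : (interior S).Nonempty := by
    rw [hS.convex.interior_nonempty_iff_affineSpan_eq_top,
      AffineSubspace.affineSpan_eq_top_iff_vectorSpan_eq_top_of_nonempty ℝ Y Y ⟨0, hS.zero_mem⟩,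
      vectorSpan_eq_span_vsub_set_right ℝ hS.zero_mem]
    simpa using hspan
  refine Set.eq_univ_of_forall fun x => ?_
  by_contra hx
  obtain ⟨f, hf0, hf⟩ := geometric_hahn_banach_of_nonempty_interior_point hS.convex
    (fun h => hx (interior_subset h)) hint
  have hneg : ∀ a ∈ S, 0 ≤ (-f) a := fun a ha =>
    hS.nonneg_of_bddBelow (f := (-f).toLinearMap) (u := -f x)
      (fun b hb => by simpa using hf b hb) ha
  have h0 := h ((InnerProductSpace.toDual ℝ Y).symm (-f)) fun a ha => by
    rw [InnerProductSpace.toDual_symm_apply]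
    exact hneg a ha
  exact hf0 (by simpa using h0)

/-- In finite dimension a convex cone whose dual is a subspace contains the orthogonal complement
of its dual. -/
theorem IsConvexCone.mem_of_dual_symm [FiniteDimensional ℝ Y] {S : Set Y} (hS : IsConvexCone S)
    (hsymm : ∀ d ∈ dualCone S, -d ∈ dualCone S) {w : Y}
    (hw : ∀ d ∈ dualCone S, inner ℝ d w = 0) : w ∈ S := by
  -- A vector `d` dual to this sum lies in `dualCone S` and pairs nonnegatively with `-d`, so it
  -- vanishes. In a decomposition `w = s + t`, both `w` and `s` are orthogonal to `dualCone S`,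
  -- which forces `t = 0`.
  have huniv : S + (Submodule.span ℝ (dualCone S) : Set Y) = Set.univ := by
    refine (hS.add (isConvexCone_submodule _)).eq_univ fun d hd => ?_
    have hdS : d ∈ dualCone S := fun x hx => hd x ⟨x, hx, 0, Submodule.zero_mem _, add_zero x⟩
    have := hd (-d) ⟨0, hS.zero_mem, -d,
      Submodule.neg_mem _ (Submodule.subset_span hdS), zero_add _⟩
    rw [inner_neg_right, Left.nonneg_neg_iff] at this
    exact inner_self_eq_zero.1 (this.antisymm real_inner_self_nonneg)
  obtain ⟨s, hs, t, ht, rfl⟩ := huniv.symm ▸ Set.mem_univ w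
  have hts : inner ℝ t s = 0 := by
    rw [real_inner_comm]
    have : s ∈ perp (dualCone S) := mem_perp.2 fun d hd => by
      have h1 := hd s hs
      have h2 := hsymm d hd s hs
      rw [inner_neg_left] at h2
      linarith
    rw [real_inner_comm]
    exact (Submodule.mem_orthogonal _ _).1 this t ht
  have htw : inner ℝ t (s + t) = 0 :=
    (Submodule.mem_orthogonal _ _).1 (mem_perp.2 hw : s + t ∈ perp (dualCone S)) t ht
  rw [inner_add_right, hts, zero_add, inner_self_eq_zero] at htw
  simpa [htw] using hs

/-- The sum of a closed set on which `⟨z, ·⟩` is nonnegative and a closed convex cone on which it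
is positive is closed. -/
theorem isClosed_add_of_inner_pos [FiniteDimensional ℝ Y] {A B : Set Y} {z : Y} (hA : IsClosed A)
    (hB : IsClosed B) (hBc : IsConvexCone B) (hzA : ∀ a ∈ A, 0 ≤ inner ℝ z a)
    (hzB : ∀ b ∈ B, b ≠ 0 → 0 < inner ℝ z b) : IsClosed (A + B) := by
  -- By compactness of the unit sphere, `⟨z, ·⟩` controls the norm on `B`. Sums `a + b` near `x`
  -- then have bounded `b`, so near `x` only a compact part of `B` matters.
  obtain ⟨c, hc, hcB⟩ : ∃ c > 0, ∀ b ∈ B, c * ‖b‖ ≤ inner ℝ z b := by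
    have hcomp : IsCompact (Metric.sphere (0 : Y) 1 ∩ B) := (isCompact_sphere 0 1).inter_right hB
    have key : ∀ b ∈ B, b ≠ 0 → ‖b‖⁻¹ • b ∈ Metric.sphere (0 : Y) 1 ∩ B := fun b hb hb0 =>
      ⟨by simp [norm_smul, hb0], hBc.smul_mem hb (by positivity)⟩
    by_cases hne : (Metric.sphere (0 : Y) 1 ∩ B).Nonempty
    · obtain ⟨b₀, hb₀, hmin⟩ := hcomp.exists_isMinOn (f := fun b => inner ℝ z b) hne (by fun_prop)
      refine ⟨inner ℝ z b₀, hzB b₀ hb₀.2 (by rintro rfl; simpa using hb₀.1), fun b hb => ?_⟩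
      by_cases hb0 : b = 0
      · simp [hb0]
      · have h1 : inner ℝ z b₀ ≤ inner ℝ z (‖b‖⁻¹ • b) := hmin (key b hb hb0)
        rw [real_inner_smul_right, inv_mul_eq_div, le_div_iff₀ (by positivity)] at h1
        exact h1
    · refine ⟨1, one_pos, fun b hb => ?_⟩
      by_cases hb0 : b = 0
      · simp [hb0]
      · exact (hne ⟨_, key b hb hb0⟩).elim
  refine isClosed_of_closure_subset fun x hx => ?_
  have hcl : IsClosed (A + (B ∩ Metric.closedBall 0 ((‖z‖ * (‖x‖ + 1)) / c))) :=
    hA.add_right_of_isCompact ((isCompact_closedBall _ _).inter_left hB)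
  have hx' : x ∈ closure (A + (B ∩ Metric.closedBall 0 ((‖z‖ * (‖x‖ + 1)) / c))) := by
    have h1 : x ∈ closure ((A + B) ∩ Metric.ball x 1) :=
      Metric.isOpen_ball.closure_inter ⟨hx, Metric.mem_ball_self one_pos⟩
    refine closure_mono ?_ h1
    rintro _ ⟨⟨a, ha, b, hb, rfl⟩, hab⟩
    refine ⟨a, ha, b, ⟨hb, ?_⟩, rfl⟩
    rw [mem_closedBall_zero_iff, le_div_iff₀ hc, mul_comm]
    calc c * ‖b‖ ≤ inner ℝ z b := hcB b hb
      _ ≤ inner ℝ z (a + b) := by rw [inner_add_right]; linarith [hzA a ha]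
      _ ≤ ‖z‖ * ‖a + b‖ := real_inner_le_norm _ _
      _ ≤ ‖z‖ * (‖x‖ + 1) := by
        gcongr
        rw [Metric.mem_ball, dist_eq_norm] at hab
        have : ‖a + b‖ ≤ ‖x‖ + ‖a + b - x‖ := norm_le_insert' _ _
        change ‖a + b - x‖ < 1 at hab
        linarith
  rw [hcl.closure_eq] at hx'
  obtain ⟨a, ha, b, hb, rfl⟩ := hx'
  exact ⟨a, ha, b, hb.1, rfl⟩

end Inner

/-! ### Feasible directions, faces and conjugate faces. -/

section Face

variable {Y : Type*} [NormedAddCommGroup Y] [InnerProductSpace ℝ Y]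

variable {K : Set Y} {z : Y}

theorem IsConvexCone.mem_of_smul_mem (hK : IsConvexCone K) {t : ℝ} (ht : 0 < t) {x : Y}
    (h : t • x ∈ K) : x ∈ K := by
  have := hK.smul_mem h (inv_nonneg.2 ht.le)
  rwa [smul_smul, inv_mul_cancel₀ ht.ne', one_smul] at this

theorem IsConvexCone.isConvexCone_dir (hK : IsConvexCone K) (hz : z ∈ K) :
    IsConvexCone (dir z K) where
  zero_mem := ⟨1, one_pos, by simpa using hz⟩
  add_mem := by
    rintro x y ⟨ε, hε, hx⟩ ⟨δ, hδ, hy⟩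
    -- With this step length, `ε + δ` times the new point is `δ • (z + ε • x) + ε • (z + δ • y)`.
    refine ⟨ε * δ / (ε + δ), by positivity, hK.mem_of_smul_mem (t := ε + δ) (by positivity) ?_⟩
    convert hK.add_mem (hK.smul_mem hx hδ.le) (hK.smul_mem hy hε.le) using 1
    rw [smul_add, smul_smul, mul_div_cancel₀ _ (by positivity)]
    module
  smul_mem := by
    rintro x t ⟨ε, hε, hx⟩ ht
    obtain rfl | ht := ht.eq_or_lt
    · exact ⟨1, one_pos, by simpa using hz⟩
    · refine ⟨ε / t, by positivity, ?_⟩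
      rwa [smul_smul, div_mul_cancel₀ _ ht.ne']

theorem IsConvexCone.subset_dir (hK : IsConvexCone K) (hz : z ∈ K) : K ⊆ dir z K :=
  fun x hx => ⟨1, one_pos, by simpa using hK.add_mem hz hx⟩

theorem IsConvexCone.smul_mem_dir (hK : IsConvexCone K) (hz : z ∈ K) (t : ℝ) :
    t • z ∈ dir z K := by
  refine ⟨(|t| + 1)⁻¹, by positivity, hK.mem_of_smul_mem (t := |t| + 1) (by positivity) ?_⟩
  rw [smul_add, smul_smul _ (_⁻¹), mul_inv_cancel₀ (by positivity), one_smul, ← add_smul]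
  exact hK.smul_mem hz (by linarith [neg_abs_le t])

/-- The conjugate of the smallest face of `K` that contains `z`: the dual vectors that are
orthogonal to `z`. -/
def annihilator (K : Set Y) (z : Y) : Set Y := dualCone K ∩ {u | inner ℝ z u = 0}

theorem isConvexCone_annihilator (K : Set Y) (z : Y) : IsConvexCone (annihilator K z) :=
  (isConvexCone_dualCone K).inter
    ⟨by simp, fun {x y} hx hy => by
      change inner ℝ z (x + y) = 0
      rw [inner_add_right, show inner ℝ z x = 0 from hx, show inner ℝ z y = 0 from hy, add_zero],
    fun {x t} hx _ => by
      change inner ℝ z (t • x) = 0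
      rw [inner_smul_right, show inner ℝ z x = 0 from hx, mul_zero]⟩

theorem inner_dir_nonneg {u d : Y} (hu : u ∈ annihilator K z) (hd : d ∈ dir z K) :
    0 ≤ inner ℝ u d := by
  obtain ⟨ε, hε, h⟩ := hd
  have h1 := hu.1 _ h
  have h2 : inner ℝ z u = 0 := hu.2
  rw [inner_add_right, real_inner_comm, h2, zero_add, inner_smul_right] at h1
  exact nonneg_of_mul_nonneg_right h1 hε

/-- The closure of the cone of feasible directions at `z` is dual to the conjugate face. -/
theorem IsConvexCone.mem_closure_dir_iff [CompleteSpace Y] (hK : IsConvexCone K) (hz : z ∈ K)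
    {d : Y} : d ∈ closure (dir z K) ↔ ∀ u ∈ annihilator K z, 0 ≤ inner ℝ u d := by
  constructor
  · intro hd u hu
    have hcl : IsClosed {d : Y | 0 ≤ inner ℝ u d} :=
      isClosed_le continuous_const (by fun_prop)
    exact closure_minimal (fun d hd => inner_dir_nonneg hu hd) hcl hd
  · intro h
    by_contra hd
    -- The cone `dir z K` contains `K` and both `z` and `-z`, so a separating `u` lies in `K^*` and
    -- is orthogonal to `z`.
    obtain ⟨u, hu, hud⟩ := (hK.isConvexCone_dir hz).exists_inner hd
    refine (h u ⟨fun x hx => hu x (hK.subset_dir hz hx), ?_⟩).not_gt hud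
    have h1 := hu _ (hK.smul_mem_dir hz 1)
    have h2 := hu _ (hK.smul_mem_dir hz (-1))
    rw [inner_smul_right] at h1 h2
    change inner ℝ z u = 0
    rw [real_inner_comm]
    linarith

/-- The face axiom speaks of midpoints only, so the argument is dyadic. For `2⁻ⁿ < ε` the point `z`
is the midpoint of `z ± 2⁻ⁿ • (x - z)`, which puts `z + 2⁻ⁿ • (x - z)` in `E`. Each of these points
is the midpoint of `z` and the next one, twice as far out, and the last of them is `x`. -/
theorem IsFace.mem_of_sub_smul_mem (hK : IsConvexCone K) {E : Set Y} (hE : IsFace K E)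
    (hz : z ∈ E) {x : Y} (hx : x ∈ K) {ε : ℝ} (hε : 0 < ε) (h : z + ε • (z - x) ∈ K) : x ∈ E := by
  have hseg : ∀ t : ℝ, 0 ≤ t → t ≤ 1 → z + t • (x - z) ∈ K := fun t h0 h1 =>
    hK.convex.add_smul_sub_mem (hE.subset hz) hx ⟨h0, h1⟩
  have hpow : ∀ n : ℕ, z + ((1 / 2 : ℝ) ^ n) • (x - z) ∈ E → x ∈ E := by
    intro n
    induction n with
    | zero => simp
    | succ n ih =>
      refine fun hn => ih (hE.mem_of_midpoint_mem z (hE.subset hz) _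
        (hseg ((1 / 2 : ℝ) ^ n) (by positivity) (pow_le_one₀ (by norm_num) (by norm_num))) ?_).2
      convert hn using 1
      rw [pow_succ]
      module
  obtain ⟨n, hn⟩ := exists_pow_lt_of_lt_one hε (by norm_num : (1 / 2 : ℝ) < 1)
  refine hpow n (hE.mem_of_midpoint_mem _ (hseg _ (by positivity)
    (pow_le_one₀ (by norm_num) (by norm_num))) (z + ((1 / 2 : ℝ) ^ n) • (z - x)) ?_ ?_).1
  · have := hK.convex.add_smul_sub_mem (hE.subset hz) h
      (t := (1 / 2 : ℝ) ^ n / ε) ⟨by positivity, by rw [div_le_one hε]; exact hn.le⟩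
    rwa [add_sub_cancel_left, smul_smul, div_mul_cancel₀ _ hε.ne'] at this
  · convert hz using 1
    module

/-- The right side is `K ∩ -dir z K`, a face because `dir z K` is a cone containing `K`. Any face
containing `z` contains it, since segments from its points to `z` prolong within `K`. -/
theorem IsConvexCone.smallestFace_eq (hK : IsConvexCone K) (hz : z ∈ K) :
    smallestFace K z = {x | x ∈ K ∧ ∃ ε : ℝ, 0 < ε ∧ z - ε • x ∈ K} := by
  have hdir : {x | x ∈ K ∧ ∃ ε : ℝ, 0 < ε ∧ z - ε • x ∈ K} = {x | x ∈ K ∧ -x ∈ dir z K} := by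
    ext x
    simp only [dir, Set.mem_ofPred_eq, smul_neg, sub_eq_add_neg]
  apply subset_antisymm
  · refine Set.sInter_subset_of_mem ⟨⟨fun x hx => hx.1, ?_, ?_⟩, ?_⟩
    · rw [hdir]
      intro x hx y hy a b ha hb hab
      refine ⟨hK.convex hx.1 hy.1 ha hb hab, ?_⟩
      convert (hK.isConvexCone_dir hz).convex hx.2 hy.2 ha hb hab using 1
      module
    · rw [hdir]
      rintro x₁ h₁ x₂ h₂ ⟨-, h⟩
      have key : ∀ a b : Y, b ∈ K → -((1 / 2 : ℝ) • (a + b)) ∈ dir z K → -a ∈ dir z K := by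
        intro a b hb hab
        convert (hK.isConvexCone_dir hz).add_mem ((hK.isConvexCone_dir hz).smul_mem hab
          (by norm_num : (0 : ℝ) ≤ 2)) (hK.subset_dir hz hb) using 1
        module
      exact ⟨⟨h₁, key x₁ x₂ h₂ h⟩, ⟨h₂, key x₂ x₁ h₁ (by rwa [add_comm])⟩⟩
    · exact ⟨hz, 1, one_pos, by simpa using hK.zero_mem⟩
  · rintro x ⟨hx, ε, hε, h⟩
    rw [smallestFace, Set.mem_sInter]
    rintro E ⟨hE, hzE⟩
    refine hE.mem_of_sub_smul_mem hK hzE hx hε ?_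
    convert hK.add_mem h (hK.smul_mem hz hε.le) using 1
    module

theorem IsConvexCone.isConvexCone_smallestFace (hK : IsConvexCone K) (hz : z ∈ K) :
    IsConvexCone (smallestFace K z) := by
  refine .of_convex ⟨z, (isLeast_smallestFace hK.convex hz).1.2⟩
    (isLeast_smallestFace hK.convex hz).1.1.convex ?_
  rw [hK.smallestFace_eq hz]
  rintro x ⟨hx, ε, hε, h⟩ t ht
  refine ⟨hK.smul_mem hx ht, ?_⟩
  obtain rfl | ht := ht.eq_or_lt
  · exact ⟨1, one_pos, by simpa using hz⟩
  · refine ⟨ε / t, by positivity, ?_⟩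
    rwa [smul_smul, div_mul_cancel₀ _ ht.ne']

theorem IsConvexCone.mem_ri_smallestFace [FiniteDimensional ℝ Y] (hK : IsConvexCone K)
    (hz : z ∈ K) : z ∈ ri (smallestFace K z) := by
  have hzF := (isLeast_smallestFace hK.convex hz).1.2
  refine (hK.isConvexCone_smallestFace hz).mem_ri_iff.2 ⟨hzF, fun x hx => ?_⟩
  rw [hK.smallestFace_eq hz] at hx ⊢
  obtain ⟨hxK, ε, hε, h⟩ := hx
  refine ⟨ε, hε, h, 1, one_pos, ?_⟩
  simpa using hK.smul_mem hxK hε.le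

theorem IsFace.eq_smallestFace [FiniteDimensional ℝ Y] (hK : IsConvexCone K) {E : Set Y}
    (hE : IsFace K E) (hz : z ∈ ri E) : E = smallestFace K z := by
  obtain ⟨hzE, h⟩ := (mem_ri_iff hE.convex).1 hz
  have hleast := isLeast_smallestFace hK.convex (hE.subset hzE)
  refine subset_antisymm (fun x hx => ?_) (hleast.2 ⟨hE, hzE⟩)
  obtain ⟨ε, hε, hx'⟩ := h x hx
  exact hleast.1.1.mem_of_sub_smul_mem hK hleast.1.2 (hE.subset hx) hε (hE.subset hx')

theorem IsConvexCone.conjugateFace_smallestFace (hK : IsConvexCone K) (hz : z ∈ K) :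
    conjugateFace K (smallestFace K z) = annihilator K z := by
  ext u
  refine and_congr_right fun hu => ?_
  rw [mem_perp]
  refine ⟨fun h => h z (isLeast_smallestFace hK.convex hz).1.2, fun h x hx => ?_⟩
  rw [hK.smallestFace_eq hz] at hx
  obtain ⟨hxK, ε, hε, hx⟩ := hx
  have h1 := hu x hxK
  have h2 := hu _ hx
  rw [inner_sub_right, inner_smul_right, real_inner_comm, show inner ℝ z u = 0 from h] at h2
  rw [real_inner_comm]
  nlinarith

/-- Only the smallest face has `z` in its relative interior, so the choice of face disappears. -/
theorem IsConvexCone.strictlyComplementary_iff [FiniteDimensional ℝ Y] (hK : IsConvexCone K)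
    (hz : z ∈ K) {u : Y} : StrictlyComplementary K u z ↔ u ∈ ri (annihilator K z) := by
  rw [← hK.conjugateFace_smallestFace hz]
  constructor
  · rintro ⟨-, E, hE, hzE, hu⟩
    rwa [← hE.eq_smallestFace hK hzE]
  · exact fun hu => ⟨(intrinsicInterior_subset hu).1, _, (isLeast_smallestFace hK.convex hz).1.1,
      hK.mem_ri_smallestFace hz, hu⟩

end Face

/-! ### The affine system and its feasible directions. -/

section System

variable {Y : Type*} [NormedAddCommGroup Y] [InnerProductSpace ℝ Y]
variable {K : Set Y} {L : Submodule ℝ Y} {z₀ z : Y}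

theorem mem_system {x : Y} : x ∈ system z₀ L K ↔ x - z₀ ∈ L ∧ x ∈ K := by
  simp only [system, Set.mem_inter_iff, Set.singleton_add, Set.mem_image, SetLike.mem_coe]
  refine and_congr_left fun _ => ⟨?_, fun h => ⟨x - z₀, h, by abel⟩⟩
  rintro ⟨l, hl, rfl⟩
  simpa using hl

theorem mem_perp_add_singleton {w : Y} :
    w ∈ perp ((L : Set Y) + {z₀}) ↔ w ∈ Lᗮ ∧ inner ℝ z₀ w = 0 := by
  rw [mem_perp, Submodule.mem_orthogonal]
  constructor
  · intro h
    have h0 : inner ℝ z₀ w = 0 := h z₀ ⟨0, L.zero_mem, z₀, rfl, zero_add _⟩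
    refine ⟨fun l hl => ?_, h0⟩
    have := h (l + z₀) ⟨l, hl, z₀, rfl, rfl⟩
    rwa [inner_add_left, h0, add_zero] at this
  · rintro ⟨h, h0⟩ _ ⟨l, hl, _, rfl, rfl⟩
    change inner ℝ (l + _) w = 0
    rw [inner_add_left, h l hl, h0, add_zero]

theorem le_lin : L ≤ lin ((L : Set Y) + {z₀}) := by
  intro l hl
  have h1 : l + z₀ ∈ lin ((L : Set Y) + {z₀}) := Submodule.subset_span ⟨l, hl, z₀, rfl, rfl⟩
  have h2 : 0 + z₀ ∈ lin ((L : Set Y) + {z₀}) :=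
    Submodule.subset_span ⟨0, L.zero_mem, z₀, rfl, rfl⟩
  simpa using Submodule.sub_mem _ h1 h2

theorem mem_lin_of_mem_system (hz : z ∈ system z₀ L K) : z ∈ lin ((L : Set Y) + {z₀}) :=
  Submodule.subset_span ⟨z - z₀, (mem_system.1 hz).1, z₀, rfl, by simp⟩

theorem exists_sub_smul_mem_of_mem_lin (hz : z ∈ system z₀ L K) {x : Y}
    (hx : x ∈ lin ((L : Set Y) + {z₀})) : ∃ t : ℝ, x - t • z ∈ L := by
  induction hx using Submodule.span_induction with
  | mem x hx =>
    obtain ⟨l, hl, _, rfl, rfl⟩ := hx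
    refine ⟨1, ?_⟩
    convert L.sub_mem hl (mem_system.1 hz).1 using 1
    simp only [one_smul]
    abel
  | zero => exact ⟨0, by simp⟩
  | add x y _ _ hx hy =>
    obtain ⟨s, hs⟩ := hx
    obtain ⟨t, ht⟩ := hy
    refine ⟨s + t, ?_⟩
    convert L.add_mem hs ht using 1
    module
  | smul c x _ hx =>
    obtain ⟨s, hs⟩ := hx
    refine ⟨c * s, ?_⟩
    convert L.smul_mem c hs using 1
    module

/-- Multiples of `z` of either sign are feasible directions, so `d` may be shifted into `L`. There
it is a feasible direction of the system, reversible at a relative interior point. -/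
theorem neg_mem_dir_of_mem_ri_system [FiniteDimensional ℝ Y] (hK : IsConvexCone K)
    (hz : z ∈ ri (system z₀ L K)) {d : Y} (hd : d ∈ lin ((L : Set Y) + {z₀}))
    (hdK : d ∈ dir z K) : -d ∈ dir z K := by
  have hconv : Convex ℝ (system z₀ L K) := by
    rw [system, Set.singleton_add]
    exact (L.convex.translate z₀).inter hK.convex
  obtain ⟨hzs, h⟩ := (mem_ri_iff hconv).1 hz
  have hzK := (mem_system.1 hzs).2
  have hdir := hK.isConvexCone_dir hzK
  obtain ⟨t, ht⟩ := exists_sub_smul_mem_of_mem_lin hzs hd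
  have hlK : d - t • z ∈ dir z K := by
    convert hdir.add_mem hdK (hK.smul_mem_dir hzK (-t)) using 1
    module
  obtain ⟨ε, hε, hlK⟩ := hlK
  have hmem : z + ε • (d - t • z) ∈ system z₀ L K := by
    refine mem_system.2 ⟨?_, hlK⟩
    convert L.add_mem (mem_system.1 hzs).1 (L.smul_mem ε ht) using 1
    abel
  obtain ⟨δ, hδ, hneg⟩ := h _ hmem
  have hl : -(d - t • z) ∈ dir z K := by
    refine ⟨δ * ε, by positivity, ?_⟩
    convert (mem_system.1 hneg).2 using 1
    module
  convert hdir.add_mem hl (hK.smul_mem_dir hzK (-t)) using 1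
  module

end System

/-! ### Conic duality and the implications between the five conditions. -/

section Duality

variable {Y : Type*} [NormedAddCommGroup Y] [InnerProductSpace ℝ Y] {K : Set Y}
  {L : Submodule ℝ Y} {z₀ z : Y}

/-- The set `(I; -z₀^*) L^⊥ + K^* × ℝ₊`. -/
def extendedSum (z₀ : Y) (L : Submodule ℝ Y) (K : Set Y) : Set (Y × ℝ) :=
  (fun w : Y => ((w, -inner ℝ z₀ w) : Y × ℝ)) '' ((Lᗮ : Submodule ℝ Y) : Set Y)
    + dualCone K ×ˢ Set.Ici (0 : ℝ)

theorem mem_extendedSum {p : Y × ℝ} : p ∈ extendedSum z₀ L K ↔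
    ∃ w ∈ Lᗮ, p.1 - w ∈ dualCone K ∧ -inner ℝ z₀ w ≤ p.2 := by
  constructor
  · rintro ⟨_, ⟨w, hw, rfl⟩, ⟨k, s⟩, ⟨hk, hs⟩, rfl⟩
    refine ⟨w, hw, by simpa using hk, ?_⟩
    simpa using hs
  · rintro ⟨w, hw, hk, hs⟩
    refine ⟨_, ⟨w, hw, rfl⟩, (p.1 - w, p.2 + inner ℝ z₀ w), ⟨hk, ?_⟩, ?_⟩
    · simp only [Set.mem_Ici]
      linarith
    · ext <;> simp

theorem isConvexCone_extendedSum : IsConvexCone (extendedSum z₀ L K) := by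
  have hD := isConvexCone_dualCone K
  refine ⟨mem_extendedSum.2 ⟨0, Submodule.zero_mem _, ?_, ?_⟩, fun {p q} hp hq => ?_,
    fun {p t} hp ht => ?_⟩
  · simpa using hD.zero_mem
  · simp
  · obtain ⟨w, hw, hk, hs⟩ := mem_extendedSum.1 hp
    obtain ⟨w', hw', hk', hs'⟩ := mem_extendedSum.1 hq
    refine mem_extendedSum.2 ⟨w + w', Submodule.add_mem _ hw hw', ?_, ?_⟩
    · convert hD.add_mem hk hk' using 1
      simp only [Prod.fst_add]
      abel
    · rw [inner_add_right, Prod.snd_add]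
      linarith
  · obtain ⟨w, hw, hk, hs⟩ := mem_extendedSum.1 hp
    refine mem_extendedSum.2 ⟨t • w, Submodule.smul_mem _ _ hw, ?_, ?_⟩
    · convert hD.smul_mem hk ht using 1
      simp only [Prod.smul_fst]
      module
    · rw [inner_smul_right, Prod.smul_snd, smul_eq_mul]
      nlinarith

/-- Weak duality. -/
theorem neg_le_inner_of_mem_extendedSum {p : Y × ℝ} (hp : p ∈ extendedSum z₀ L K) {x : Y}
    (hx : x ∈ system z₀ L K) : -p.2 ≤ inner ℝ p.1 x := by
  obtain ⟨w, hw, hk, hs⟩ := mem_extendedSum.1 hp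
  obtain ⟨hxL, hxK⟩ := mem_system.1 hx
  have h1 := hk x hxK
  have h2 := (Submodule.mem_orthogonal _ _).1 hw _ hxL
  rw [inner_sub_left] at h1 h2
  rw [real_inner_comm] at h2
  linarith

theorem le_inner_of_primalVal {y₀ : Y} {v : ℝ} (h : primalVal z₀ L K y₀ = v) {x : Y}
    (hx : x ∈ system z₀ L K) : v ≤ inner ℝ y₀ x := by
  rw [← EReal.coe_le_coe_iff, ← h]
  exact iInf₂_le x hx

theorem le_of_primalVal {y₀ : Y} {v c : ℝ} (h : primalVal z₀ L K y₀ = v)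
    (hc : ∀ x ∈ system z₀ L K, c ≤ inner ℝ y₀ x) : c ≤ v := by
  rw [← EReal.coe_le_coe_iff, ← h]
  exact le_iInf₂ fun x hx => EReal.coe_le_coe_iff.2 (hc x hx)

theorem exists_primalVal_eq (hz : z ∈ system z₀ L K) {y₀ : Y} {c : ℝ}
    (hc : ∀ x ∈ system z₀ L K, c ≤ inner ℝ y₀ x) : ∃ v : ℝ, primalVal z₀ L K y₀ = v := by
  have h1 : (c : EReal) ≤ primalVal z₀ L K y₀ :=
    le_iInf₂ fun x hx => EReal.coe_le_coe_iff.2 (hc x hx)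
  have h2 : primalVal z₀ L K y₀ ≤ (inner ℝ y₀ z : ℝ) := iInf₂_le z hz
  refine ⟨(primalVal z₀ L K y₀).toReal, (EReal.coe_toReal ?_ ?_).symm⟩
  · exact (h2.trans_lt (EReal.coe_lt_top _)).ne
  · exact ((EReal.bot_lt_coe _).trans_le h1).ne'

theorem mem_dualFeasible {y₀ y : Y} :
    y ∈ dualFeasible L K y₀ ↔ y₀ - y ∈ Lᗮ ∧ y ∈ dualCone K := by
  simp only [dualFeasible, Set.mem_inter_iff, Set.singleton_add, Set.mem_image, SetLike.mem_coe]
  refine and_congr_left fun _ => ⟨?_, fun h => ⟨-(y₀ - y), Submodule.neg_mem _ h, by abel⟩⟩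
  rintro ⟨w, hw, rfl⟩
  simpa using hw

/-- Dual attainment for a finite value `v` means that `(y₀, -v)` lies in the extended sum. -/
theorem exists_dualFeasible_iff {y₀ : Y} {v : ℝ} (h : primalVal z₀ L K y₀ = v) :
    (∃ y ∈ dualFeasible L K y₀, inner ℝ z₀ y + v = inner ℝ z₀ y₀) ↔
      (y₀, -v) ∈ extendedSum z₀ L K := by
  rw [mem_extendedSum]
  constructor
  · rintro ⟨y, hy, hyv⟩
    obtain ⟨hyL, hyK⟩ := mem_dualFeasible.1 hy
    refine ⟨y₀ - y, hyL, by simpa using hyK, ?_⟩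
    simp only [inner_sub_right]
    linarith
  · rintro ⟨w, hw, hk, hs⟩
    refine ⟨y₀ - w, mem_dualFeasible.2 ⟨by simpa using hw, hk⟩, ?_⟩
    -- Weak duality bounds the dual value by `v`; with `hs` this gives equality.
    have := le_of_primalVal h (c := inner ℝ z₀ w) fun x hx => by
      have := neg_le_inner_of_mem_extendedSum
        (mem_extendedSum.2 ⟨w, hw, hk, le_rfl⟩ : (y₀, -inner ℝ z₀ w) ∈ extendedSum z₀ L K) hx
      simpa using this
    simp only at hs
    rw [inner_sub_right]
    linarith

/-- The closure of the extended sum consists of the valid lower bounds. -/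
theorem mem_closure_extendedSum_iff [FiniteDimensional ℝ Y] (hK : IsConvexCone K)
    (hcl : IsClosed K) (hz : z ∈ system z₀ L K) {p : Y × ℝ} :
    p ∈ closure (extendedSum z₀ L K) ↔ ∀ x ∈ system z₀ L K, -p.2 ≤ inner ℝ p.1 x := by
  constructor
  · intro hp x hx
    have hcl : IsClosed {p : Y × ℝ | -p.2 ≤ inner ℝ p.1 x} :=
      isClosed_le (by fun_prop) (by fun_prop)
    exact closure_minimal (fun q hq => neg_le_inner_of_mem_extendedSum hq hx) hcl hp
  · intro h
    by_contra hp
    -- The functional is a pair `(x, t)` with `t ≥ 0`, `x ∈ K` and `x - t • z₀ ∈ L`. For `t > 0` the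
    -- feasible point `t⁻¹ • x` violates the lower bound; for `t = 0`, `x` is a recession direction
    -- along which the objective decreases.
    obtain ⟨f, hf, hfp⟩ := isConvexCone_extendedSum.exists_functional hp
    set x := (InnerProductSpace.toDual ℝ Y).symm (f.comp (ContinuousLinearMap.inl ℝ Y ℝ))
    set t := f (0, 1)
    have hfxt : ∀ (y : Y) (r : ℝ), f (y, r) = inner ℝ x y + r * t := by
      intro y r
      have : ((y, r) : Y × ℝ) = (y, 0) + r • (0, 1) := by ext <;> simp
      rw [this, map_add, map_smul, smul_eq_mul, InnerProductSpace.toDual_symm_apply]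
      rfl
    have ht : 0 ≤ t := by
      have := hf (0, 1) (mem_extendedSum.2 ⟨0, Submodule.zero_mem _,
        by simpa using (isConvexCone_dualCone K).zero_mem, by simp⟩)
      simpa [hfxt] using this
    have hxK : x ∈ K := hK.mem_of_inner_nonneg hcl fun y hy => by
      have := hf (y, 0) (mem_extendedSum.2 ⟨0, Submodule.zero_mem _, by simpa using hy, by simp⟩)
      rw [hfxt] at this
      rw [real_inner_comm]
      simpa using this
    have hxL : x - t • z₀ ∈ L := by
      rw [← L.orthogonal_orthogonal, Submodule.mem_orthogonal]
      have key : ∀ w ∈ Lᗮ, 0 ≤ inner ℝ w (x - t • z₀) := fun w hw => by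
        have := hf (w, -inner ℝ z₀ w) (mem_extendedSum.2 ⟨w, hw,
          by simpa using (isConvexCone_dualCone K).zero_mem, le_rfl⟩)
        rw [hfxt, real_inner_comm] at this
        rw [inner_sub_right, inner_smul_right, real_inner_comm z₀ w]
        linarith
      intro w hw
      have h1 := key w hw
      have h2 := key (-w) (Submodule.neg_mem _ hw)
      rw [inner_neg_left] at h2
      linarith
    obtain ⟨y, r⟩ := p
    rw [hfxt, real_inner_comm] at hfp
    simp only at h
    obtain ht0 | ht := ht.eq_or_lt
    · rw [← ht0] at hxL hfp
      rw [mul_zero, add_zero] at hfp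
      rw [zero_smul, sub_zero] at hxL
      obtain ⟨hzL, hzK⟩ := mem_system.1 hz
      -- Moving from `z` this far along `x` brings the objective down to `-r - 1`.
      have hn : 0 ≤ (r + inner ℝ y z + 1) / -inner ℝ y x := by
        have := h z hz
        exact div_nonneg (by linarith) (by linarith)
      have := h (z + ((r + inner ℝ y z + 1) / -inner ℝ y x) • x) (mem_system.2 ⟨by
        convert L.add_mem hzL (L.smul_mem ((r + inner ℝ y z + 1) / -inner ℝ y x) hxL) using 1
        abel, hK.add_mem hzK (hK.smul_mem hxK hn)⟩)
      rw [inner_add_right, inner_smul_right, div_neg, neg_mul, div_mul_cancel₀ _ hfp.ne] at this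
      linarith
    · have := h (t⁻¹ • x) (mem_system.2 ⟨by
        convert L.smul_mem t⁻¹ hxL using 1
        rw [smul_sub, smul_smul, inv_mul_cancel₀ ht.ne', one_smul],
        hK.smul_mem hxK (inv_nonneg.2 ht.le)⟩)
      rw [inner_smul_right, inv_mul_eq_div, le_div_iff₀ ht] at this
      linarith

theorem wellBehaved_iff_extendedSumClosed [FiniteDimensional ℝ Y] (hK : IsConvexCone K)
    (hcl : IsClosed K) (hz : z ∈ system z₀ L K) :
    WellBehaved z₀ L K ↔ ExtendedSumClosed z₀ L K := by
  constructor
  · refine fun h => isClosed_of_closure_subset (s := extendedSum z₀ L K) fun p hp => ?_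
    have hp' := (mem_closure_extendedSum_iff hK hcl hz).1 hp
    obtain ⟨v, hv⟩ := exists_primalVal_eq hz hp'
    obtain ⟨w, hw, hk, hs⟩ := mem_extendedSum.1 ((exists_dualFeasible_iff hv).1 (h _ _ hv))
    refine mem_extendedSum.2 ⟨w, hw, hk, hs.trans ?_⟩
    have := le_of_primalVal hv hp'
    simp only
    linarith
  · intro h y₀ v hv
    rw [exists_dualFeasible_iff hv]
    have h' : IsClosed (extendedSum z₀ L K) := h
    rw [← h'.closure_eq, mem_closure_extendedSum_iff hK hcl hz]
    intro x hx
    rw [neg_neg]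
    exact le_inner_of_primalVal hv hx

/-- If `z₀` is orthogonal to `L^⊥`, the extended sum is a product with a half-line. Otherwise take
`w₀ ∈ L^⊥` with `⟨z₀, w₀⟩ = 1`: the extended sum is the preimage under `(y, r) ↦ y + r • w₀` of the
sum in (3') enlarged by the ray of `w₀`. The enlargement is closed, since `⟨z, ·⟩` is nonnegative on
the sum and positive on the ray away from `0`. -/
theorem SumClosed.extendedSumClosed [FiniteDimensional ℝ Y] (hz : z ∈ system z₀ L K)
    (h : SumClosed z₀ L K) : ExtendedSumClosed z₀ L K := by
  change IsClosed (extendedSum z₀ L K)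
  by_cases hzL : ∀ w ∈ Lᗮ, inner ℝ z₀ w = 0
  · have : extendedSum z₀ L K = (perp ((L : Set Y) + {z₀}) + dualCone K) ×ˢ Set.Ici (0 : ℝ) := by
      ext ⟨y, r⟩
      rw [mem_extendedSum, Set.mem_prod]
      constructor
      · rintro ⟨w, hw, hk, hs⟩
        exact ⟨⟨w, mem_perp_add_singleton.2 ⟨hw, hzL w hw⟩, y - w, hk, add_sub_cancel _ _⟩,
          by simpa [hzL w hw] using hs⟩
      · rintro ⟨⟨w, hw, k, hk, hwk⟩, hr⟩
        obtain ⟨hwL, hw0⟩ := mem_perp_add_singleton.1 hw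
        refine ⟨w, hwL, ?_, by simpa [hw0] using hr⟩
        rw [← hwk]
        simpa using hk
    rw [this]
    exact h.prod isClosed_Ici
  · push Not at hzL
    obtain ⟨w₁, hw₁, hne⟩ := hzL
    set w₀ := (inner ℝ z₀ w₁)⁻¹ • w₁
    have hw₀ : w₀ ∈ Lᗮ := Submodule.smul_mem _ _ hw₁
    have hzw₀ : inner ℝ z₀ w₀ = 1 := by rw [inner_smul_right, inv_mul_cancel₀ hne]
    have hzz : ∀ w ∈ Lᗮ, inner ℝ z w = inner ℝ z₀ w := fun w hw => by
      have := (Submodule.mem_orthogonal _ _).1 hw _ (mem_system.1 hz).1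
      rw [inner_sub_left] at this
      linarith
    have hray : IsConvexCone ((fun s : ℝ => s • w₀) '' Set.Ici 0) := by
      refine ⟨⟨0, Set.self_mem_Ici, zero_smul _ _⟩, ?_, ?_⟩
      · rintro _ _ ⟨s, hs, rfl⟩ ⟨t, ht, rfl⟩
        exact ⟨s + t, Set.mem_Ici.2 (add_nonneg hs ht), add_smul _ _ _⟩
      · rintro _ t ⟨s, hs, rfl⟩ ht
        exact ⟨t * s, Set.mem_Ici.2 (mul_nonneg ht hs), mul_smul _ _ _⟩
    have hclosed : IsClosed (perp ((L : Set Y) + {z₀}) + dualCone K +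
        (fun s : ℝ => s • w₀) '' Set.Ici 0) := by
      refine isClosed_add_of_inner_pos (z := z) h ((isClosedMap_smul_left w₀) _ isClosed_Ici)
        hray ?_ ?_
      · rintro _ ⟨w, hw, k, hk, rfl⟩
        obtain ⟨hwL, hw0⟩ := mem_perp_add_singleton.1 hw
        rw [inner_add_right, hzz w hwL, hw0, zero_add, real_inner_comm]
        exact hk z (mem_system.1 hz).2
      · rintro _ ⟨s, hs, rfl⟩ hs0
        simp only [inner_smul_right, hzz w₀ hw₀, hzw₀, mul_one]
        exact lt_of_le_of_ne hs (by rintro rfl; simp at hs0)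
    have : extendedSum z₀ L K = (fun p : Y × ℝ => p.1 + p.2 • w₀) ⁻¹'
        (perp ((L : Set Y) + {z₀}) + dualCone K + (fun s : ℝ => s • w₀) '' Set.Ici 0) := by
      ext ⟨y, r⟩
      rw [mem_extendedSum]
      constructor
      · rintro ⟨w, hw, hk, hs⟩
        refine ⟨_, ⟨w - inner ℝ z₀ w • w₀, mem_perp_add_singleton.2
          ⟨Submodule.sub_mem _ hw (Submodule.smul_mem _ _ hw₀), ?_⟩, _, hk, rfl⟩, _,
          ⟨r + inner ℝ z₀ w, ?_, rfl⟩, ?_⟩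
        · rw [inner_sub_right, inner_smul_right, hzw₀, mul_one, sub_self]
        · simp only at hs
          rw [Set.mem_Ici]
          linarith
        · simp only
          module
      · rintro ⟨_, ⟨w, hw, k, hk, rfl⟩, _, ⟨s, hs, rfl⟩, hsum⟩
        simp only at hsum
        obtain ⟨hwL, hw0⟩ := mem_perp_add_singleton.1 hw
        refine ⟨w + (s - r) • w₀, Submodule.add_mem _ hwL (Submodule.smul_mem _ _ hw₀), ?_, ?_⟩
        · convert hk using 1
          rw [← sub_eq_zero]
          have : y = w + k + s • w₀ - r • w₀ := by rw [hsum]; module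
          simp only
          rw [this]
          module
        · rw [inner_add_right, inner_smul_right, hzw₀, hw0]
          have : (0 : ℝ) ≤ s := hs
          simp only
          linarith
    rw [this]
    exact hclosed.preimage (by fun_prop)

/-- A violating `d`, shifted by a multiple of `z`, becomes `e ∈ L` outside the subspace `T = L ∩ dir
z K`. An objective `y₀` nonnegative on `T` and negative at `e` is minimized at `z`. A dual solution
`y` would be orthogonal to `z` and agree with `y₀` on `L`, so `⟨y, e⟩ < 0`, contrary to `e ∈ cl
dir(z, K)`. -/
theorem WellBehaved.frontierCondition [FiniteDimensional ℝ Y] (hK : IsConvexCone K)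
    (hz : z ∈ ri (system z₀ L K)) (h : WellBehaved z₀ L K) : FrontierCondition z₀ L K z := by
  have hzs := intrinsicInterior_subset hz
  obtain ⟨hzL, hzK⟩ := mem_system.1 hzs
  have hdir := hK.isConvexCone_dir hzK
  refine Set.eq_empty_of_forall_notMem ?_
  rintro d ⟨hd, hdcl, hdK⟩
  obtain ⟨t, ht⟩ := exists_sub_smul_mem_of_mem_lin hzs hd
  set e := d - t • z
  have hecl : e ∈ closure (dir z K) := (hK.mem_closure_dir_iff hzK).2 fun u hu => by
    have h2 : inner ℝ z u = 0 := hu.2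
    rw [inner_sub_right, inner_smul_right, real_inner_comm z u, h2, mul_zero, sub_zero]
    exact (hK.mem_closure_dir_iff hzK).1 hdcl u hu
  have heT : e ∉ dir z K := fun he => hdK <| by
    convert hdir.add_mem he (hK.smul_mem_dir hzK t) using 1
    simp [e]
  have hneg : ∀ {x}, x ∈ (L : Set Y) ∩ dir z K → -x ∈ (L : Set Y) ∩ dir z K := fun hx =>
    ⟨L.neg_mem hx.1, neg_mem_dir_of_mem_ri_system hK hz (le_lin hx.1) hx.2⟩
  let T : Submodule ℝ Y :=
    { carrier := (L : Set Y) ∩ dir z K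
      zero_mem' := ⟨L.zero_mem, hdir.zero_mem⟩
      add_mem' := ((isConvexCone_submodule L).inter hdir).add_mem
      smul_mem' := fun c x hx => by
        rcases le_total 0 c with hc | hc
        · exact ((isConvexCone_submodule L).inter hdir).smul_mem hx hc
        · have := ((isConvexCone_submodule L).inter hdir).smul_mem (hneg hx) (neg_nonneg.2 hc)
          rwa [smul_neg, neg_smul, neg_neg] at this }
  have heT' : e ∉ closure (T : Set Y) := by
    rw [T.closed_of_finiteDimensional.closure_eq]
    exact fun h => heT h.2
  obtain ⟨y₀, hy₀, hy₀e⟩ := (isConvexCone_submodule T).exists_inner heT'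
  have hconst : ∀ x ∈ system z₀ L K, inner ℝ y₀ z ≤ inner ℝ y₀ x := fun x hx => by
    obtain ⟨hxL, hxK⟩ := mem_system.1 hx
    have hmem : x - z ∈ T := ⟨by simpa using L.sub_mem hxL hzL, 1, one_pos, by simpa using hxK⟩
    have := hy₀ _ hmem
    rw [inner_sub_right] at this
    linarith
  obtain ⟨v, hv⟩ := exists_primalVal_eq hzs hconst
  have hvz : v = inner ℝ y₀ z :=
    (le_inner_of_primalVal hv hzs).antisymm (le_of_primalVal hv hconst)
  obtain ⟨y, hy, hyv⟩ := h y₀ v hv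
  obtain ⟨hyL, hyK⟩ := mem_dualFeasible.1 hy
  have h1 := (Submodule.mem_orthogonal _ _).1 hyL _ hzL
  have h2 := (Submodule.mem_orthogonal _ _).1 hyL _ ht
  rw [inner_sub_right, inner_sub_left, inner_sub_left] at h1
  rw [inner_sub_right] at h2
  have hyz : inner ℝ z y = 0 := by
    rw [real_inner_comm] at hvz
    linarith
  have h3 := (hK.mem_closure_dir_iff hzK).1 hecl y ⟨hyK, hyz⟩
  rw [real_inner_comm] at h3 hy₀e
  linarith

/-- Under the frontier condition `(L + z₀)^⊥ + F^△` is the orthogonal complement of a subspace. -/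
theorem FrontierCondition.mem_perp_add_annihilator [FiniteDimensional ℝ Y] (hK : IsConvexCone K)
    (hz : z ∈ ri (system z₀ L K)) (h : FrontierCondition z₀ L K z) {w : Y}
    (hw : ∀ d ∈ ldir z K, inner ℝ d w = 0) :
    w ∈ perp ((L : Set Y) + {z₀}) + annihilator K z := by
  have hzs := intrinsicInterior_subset hz
  have hzK := (mem_system.1 hzs).2
  have hP := isConvexCone_perp ((L : Set Y) + {z₀})
  have hN := isConvexCone_annihilator K z
  have key : ∀ d ∈ dualCone (perp ((L : Set Y) + {z₀}) + annihilator K z),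
      d ∈ lin ((L : Set Y) + {z₀}) ∧ d ∈ dir z K ∧ -d ∈ dir z K := by
    intro d hd
    have hdV : d ∈ lin ((L : Set Y) + {z₀}) := by
      rw [← Submodule.orthogonal_orthogonal (lin (_ : Set Y)), Submodule.mem_orthogonal]
      intro a ha
      have h1 := hd a ⟨a, ha, 0, hN.zero_mem, add_zero a⟩
      have h2 := hd (-a) ⟨-a, Submodule.neg_mem _ ha, 0, hN.zero_mem, add_zero _⟩
      rw [inner_neg_right] at h2
      rw [real_inner_comm]
      linarith
    have hdcl : d ∈ closure (dir z K) := (hK.mem_closure_dir_iff hzK).2 fun u hu => by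
      rw [real_inner_comm]
      exact hd u ⟨0, hP.zero_mem, u, hu, zero_add u⟩
    have hdK : d ∈ dir z K := by
      by_contra hdK
      exact (h.le ⟨hdV, hdcl, hdK⟩ : d ∈ (∅ : Set Y))
    exact ⟨hdV, hdK, neg_mem_dir_of_mem_ri_system hK hz hdV hdK⟩
  refine (hP.add hN).mem_of_dual_symm (fun d hd => ?_) fun d hd => hw d (key d hd).2
  obtain ⟨hdV, -, hdK⟩ := key d hd
  rintro _ ⟨a, ha, u, hu, rfl⟩
  have h1 : inner ℝ d a = 0 := (Submodule.mem_orthogonal _ _).1 ha _ hdV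
  have h2 := inner_dir_nonneg hu hdK
  change 0 ≤ inner ℝ (-d) (a + u)
  rw [inner_add_right, inner_neg_left, h1, neg_zero, zero_add, real_inner_comm]
  exact h2

theorem frontierCondition_iff_tangentCondition [FiniteDimensional ℝ Y] (hK : IsConvexCone K)
    (hz : z ∈ ri (system z₀ L K)) :
    FrontierCondition z₀ L K z ↔ TangentCondition z₀ L K z := by
  have hzs := intrinsicInterior_subset hz
  have hzK := (mem_system.1 hzs).2
  have hN := isConvexCone_annihilator K z
  constructor
  · intro h
    refine ⟨?_, Set.eq_empty_of_forall_notMem ?_⟩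
    · obtain ⟨u₀, hu₀⟩ := Set.Nonempty.intrinsicInterior hN.convex ⟨0, hN.zero_mem⟩
      have hu₀' := hN.mem_ri_iff.1 hu₀
      -- Writing `-u₀ = a + f` gives `u₀ + f = -a`, which lies in `(L + z₀)^⊥` and, as `u₀` plus an
      -- element of the cone, stays in the relative interior.
      obtain ⟨a, ha, f, hf, haf⟩ := h.mem_perp_add_annihilator hK hz (w := -u₀) fun d hd => by
        have h1 := inner_dir_nonneg hu₀'.1 hd.1
        have h2 := inner_dir_nonneg hu₀'.1 (Set.mem_neg.1 hd.2)
        rw [inner_neg_right] at h2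
        rw [inner_neg_right, real_inner_comm]
        linarith
      have hsum : u₀ + f = -a := by
        have : a + f = -u₀ := haf
        rw [← sub_eq_zero, sub_neg_eq_add, add_assoc, add_comm f, this, add_neg_cancel]
      refine ⟨u₀ + f, hsum ▸ Submodule.neg_mem _ ha, ?_⟩
      refine (hK.strictlyComplementary_iff hzK).2 (hN.mem_ri_iff.2
        ⟨hN.add_mem hu₀'.1 hf, fun y hy => ?_⟩)
      obtain ⟨ε, hε, h1⟩ := hu₀'.2 y hy
      refine ⟨ε, hε, ?_⟩
      convert hN.add_mem h1 hf using 1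
      abel
    · rintro d ⟨hdV, hdt, hdl⟩
      have key : ∀ x ∈ lin ((L : Set Y) + {z₀}), x ∈ closure (dir z K) → x ∈ dir z K := by
        intro x hxV hxcl
        by_contra hxK
        exact (h.le ⟨hxV, hxcl, hxK⟩ : x ∈ (∅ : Set Y))
      exact hdl ⟨key d hdV hdt.1, key (-d) (Submodule.neg_mem _ hdV) hdt.2⟩
  · rintro ⟨⟨u, huP, hu⟩, h⟩
    obtain ⟨huN, hu⟩ := hN.mem_ri_iff.1 ((hK.strictlyComplementary_iff hzK).1 hu)
    refine Set.eq_empty_of_forall_notMem ?_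
    rintro d ⟨hdV, hdcl, hdK⟩
    have hdu : inner ℝ u d = 0 := by
      rw [real_inner_comm]
      exact (Submodule.mem_orthogonal _ _).1 huP d hdV
    -- Since `u - ε • f` stays in the conjugate face and `⟨u, d⟩ = 0`, the pairing `⟨f, d⟩` cannot
    -- be positive.
    have hdcl' : -d ∈ closure (dir z K) := (hK.mem_closure_dir_iff hzK).2 fun f hf => by
      obtain ⟨ε, hε, h1⟩ := hu f hf
      have h2 := (hK.mem_closure_dir_iff hzK).1 hdcl _ h1
      rw [inner_sub_left, hdu, zero_sub, real_inner_smul_left, ← mul_neg] at h2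
      rw [inner_neg_right]
      exact nonneg_of_mul_nonneg_right h2 hε
    exact (h.le ⟨hdV, ⟨hdcl, hdcl'⟩, fun hl => hdK hl.1⟩ : d ∈ (∅ : Set Y))

/-- Because `F^⊥ ⊆ (L + z₀)^⊥ + F^△`, adding `F^⊥` does not change the sum in (3'). What remains of
`K^*` is its part modulo `F^⊥`, represented in `lin F`, where `⟨z, ·⟩` is positive away from `0`. -/
theorem FrontierCondition.sumClosed [FiniteDimensional ℝ Y] (hK : IsConvexCone K)
    (hz : z ∈ ri (system z₀ L K)) (hnice : IsClosed (dualCone K + perp (smallestFace K z)))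
    (h : FrontierCondition z₀ L K z) : SumClosed z₀ L K := by
  have hzs := intrinsicInterior_subset hz
  have hzK := (mem_system.1 hzs).2
  have hzF := (isLeast_smallestFace hK.convex hzK).1.2
  have hD := isConvexCone_dualCone K
  have hN := isConvexCone_annihilator K z
  set F := smallestFace K z
  set V := lin ((L : Set Y) + {z₀})
  have hperpF : perp F ⊆ perp ((L : Set Y) + {z₀}) + annihilator K z := by
    refine fun w hw => h.mem_perp_add_annihilator hK hz fun d hd => ?_
    obtain ⟨⟨ε, hε, h1⟩, ⟨δ, hδ, h2⟩⟩ := hd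
    have hmem : z + ε • d ∈ F := by
      simp only [F, hK.smallestFace_eq hzK]
      -- This choice makes `(ε + δ) / ε` times the prolonged point equal to `z - δ • d`.
      refine ⟨h1, δ / (ε + δ), by positivity, hK.mem_of_smul_mem (t := (ε + δ) / ε)
        (by positivity) ?_⟩
      convert h2 using 1
      rw [smul_sub, smul_smul, div_mul_div_cancel₀' (by positivity), add_div, div_self hε.ne',
        smul_add, smul_smul, div_mul_cancel₀ _ hε.ne']
      module
    have h3 := mem_perp.1 hw _ hmem
    rw [inner_add_left, mem_perp.1 hw z hzF, zero_add, real_inner_smul_left] at h3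
    exact (mul_eq_zero.1 h3).resolve_left hε.ne'
  have hsum : perp ((L : Set Y) + {z₀}) + dualCone K =
      ((Vᗮ ⊔ (lin F)ᗮ : Submodule ℝ Y) : Set Y) + ((dualCone K + perp F) ∩ lin F) := by
    apply subset_antisymm
    · rintro _ ⟨a, ha, k, hk, rfl⟩
      have hq : k - (lin F).starProjection k ∈ (lin F)ᗮ :=
        Submodule.sub_starProjection_mem_orthogonal k
      refine ⟨a + (k - (lin F).starProjection k), Submodule.add_mem_sup ha hq,
        (lin F).starProjection k, ⟨⟨k, hk, -(k - (lin F).starProjection k),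
          Submodule.neg_mem _ hq, ?_⟩, Submodule.starProjection_apply_mem _ k⟩, ?_⟩
      · simp
      · simp [add_assoc]
    · rintro _ ⟨b, hb, _, ⟨⟨k, hk, q, hq, rfl⟩, -⟩, rfl⟩
      obtain ⟨a, ha, q', hq', rfl⟩ := Submodule.mem_sup.1 hb
      obtain ⟨a', ha', u, hu, hau⟩ := hperpF (Submodule.add_mem _ hq' hq : q' + q ∈ (lin F)ᗮ)
      refine ⟨a + a', Submodule.add_mem _ ha ha', u + k, hD.add_mem hu.1 hk, ?_⟩
      have : a' + u = q' + q := hau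
      change a + a' + (u + k) = a + q' + (k + q)
      rw [add_assoc a, ← add_assoc a', this]
      abel
  rw [SumClosed, hsum]
  refine isClosed_add_of_inner_pos (z := z) (Submodule.closed_of_finiteDimensional _)
    (hnice.inter (Submodule.closed_of_finiteDimensional _))
    ((hD.add (isConvexCone_perp F)).inter (isConvexCone_submodule _)) ?_ ?_
  · intro b hb
    obtain ⟨a, ha, q, hq, rfl⟩ := Submodule.mem_sup.1 hb
    rw [inner_add_right, mem_perp.1 hq z hzF, add_zero]
    exact ((Submodule.mem_orthogonal _ _).1 ha z (mem_lin_of_mem_system hzs)).ge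
  · rintro b ⟨⟨k, hk, q, hq, rfl⟩, hb⟩ hb0
    change 0 < inner ℝ z (k + q)
    rw [inner_add_right, mem_perp.1 hq z hzF, add_zero]
    refine lt_of_le_of_ne (by rw [real_inner_comm]; exact hk z hzK) fun hk0 => hb0 ?_
    -- If `⟨z, k⟩ = 0` then `k ∈ F^△`, so `k + q` lies in both `F^⊥` and `lin F` and vanishes.
    have hkF : k ∈ perp F := by
      have : k ∈ conjugateFace K F := by
        rw [hK.conjugateFace_smallestFace hzK]
        exact ⟨hk, hk0.symm⟩
      exact this.2
    exact inner_self_eq_zero.1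
      ((Submodule.mem_orthogonal _ _).1 (Submodule.add_mem _ hkF hq : k + q ∈ (lin F)ᗮ) _ hb)

end Duality

end ConicSubspace

theorem theorem5p1 {Y : Type*} [NormedAddCommGroup Y] [InnerProductSpace ℝ Y]
    [FiniteDimensional ℝ Y] (K : Set Y) (hK_closed : IsClosed K) (hK_convex : Convex ℝ K)
    (hK_cone : ∀ x ∈ K, ∀ t : ℝ, 0 ≤ t → t • x ∈ K) (L : Submodule ℝ Y) (z₀ z : Y)
    (hz : z ∈ ConicSubspace.ri (ConicSubspace.system z₀ L K)) :
    (ConicSubspace.WellBehaved z₀ L K ↔ ConicSubspace.ExtendedSumClosed z₀ L K) ∧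
    (ConicSubspace.SumClosed z₀ L K → ConicSubspace.ExtendedSumClosed z₀ L K) ∧
    (ConicSubspace.ExtendedSumClosed z₀ L K → ConicSubspace.FrontierCondition z₀ L K z) ∧
    (ConicSubspace.FrontierCondition z₀ L K z ↔ ConicSubspace.TangentCondition z₀ L K z) ∧
    (IsClosed (ConicSubspace.dualCone K +
        ConicSubspace.perp (ConicSubspace.smallestFace K z)) →
      List.TFAE [ConicSubspace.WellBehaved z₀ L K,
        ConicSubspace.ExtendedSumClosed z₀ L K,
        ConicSubspace.SumClosed z₀ L K,
        ConicSubspace.FrontierCondition z₀ L K z,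
        ConicSubspace.TangentCondition z₀ L K z]) := by
  have hzs := intrinsicInterior_subset hz
  have hK : ConicSubspace.IsConvexCone K :=
    .of_convex ⟨z, (ConicSubspace.mem_system.1 hzs).2⟩ hK_convex hK_cone
  have h12 := ConicSubspace.wellBehaved_iff_extendedSumClosed hK hK_closed hzs
  have h32 : ConicSubspace.SumClosed z₀ L K → ConicSubspace.ExtendedSumClosed z₀ L K :=
    ConicSubspace.SumClosed.extendedSumClosed hzs
  have h24 : ConicSubspace.ExtendedSumClosed z₀ L K →
      ConicSubspace.FrontierCondition z₀ L K z := fun h => (h12.2 h).frontierCondition hK hz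
  have h45 := ConicSubspace.frontierCondition_iff_tangentCondition hK hz
  refine ⟨h12, h32, h24, h45, fun hnice => ?_⟩
  tfae_have 1 ↔ 2 := h12
  tfae_have 3 → 2 := h32
  tfae_have 2 → 4 := h24
  tfae_have 4 ↔ 5 := h45
  tfae_have 4 → 3 := fun h => h.sumClosed hK hz hnice
  tfae_finish
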